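/- Conventions. For $\alpha>0$ and $0<p<1$ let $N_{\alpha,p}$ denote a negative binomial random variable, $P(N_{\alpha,p}=k)=\binom{k+\alpha-1}{k}p^{\alpha}(1-p)^k$ for $k=0,1,2,\dots$; for $\alpha,\beta>0$ let $G_{\alpha,\beta}$ denote a gamma random variable, with density $\frac{\beta^{\alpha}t^{\alpha-1}}{\Gamma(\alpha)}e^{-\beta t}$ for $t\ge 0$ and $0$ for $t<0$. For $\vec\alpha,\vec p,\vec\beta\in\mathbb R^n$ with all $\alpha_i>0$, $0<p_i<1$, $\beta_i>0$, put $\mathcal N_{\vec\alpha,\vec p}=\sum_{i=1}^n N_{\alpha_i,p_i}$ and $\mathcal G_{\vec\alpha,\vec\beta}=\sum_{i=1}^n G_{\alpha_i,\beta_i}$, with independent summands. Write $\log\vec p=(\log p_1,\dots,\log p_n)$, and similarly for $\log\vec\beta$. For real random variables, $X_1\le_{st}X_2$ means that $X_2$ has the same distribution as $X_1'+Z$ for some random variables $X_1',Z$ on a common probability space, where $X_1'$ has the same distribution as $X_1$ and $Z\ge 0$ almost surely ($Z$ need not be independent of $X_1'$). For $x,y\in\mathbb R^m$, $x\prec y$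 (majorization) means that for each $k=1,\dots,m$ the sum of the $k$ largest components of $x$ is at most that of $y$, with equality for $k=m$. Consider pairs $(\vec x,\vec y)\in\mathbb R^n\times\mathbb R^n$, two pairs being identified if one arises from the other by applying the same permutation of the coordinates to both vectors. The reverse-coupled majorization order $\stackrel{rc}{\prec}$ relates $(\vec x_1,\vec y_1)$ to $(\vec x_2,\vec y_2)$ if, modulo this identification, one passes from the first to the second by a finite (possibly empty) chain of pairs in $\mathbb R^n\times\mathbb R^n$ in which each pair $(\vec x_1,\vec y_1)$ and its successor $(\vec x_2,\vec y_2)$ satisfy one of the following: (i) for some $i<j$ with $(y_{2j}-y_{2i})(x_{2j}-x_{2i})\le 0$: $(x_{1i},x_{1j})\prec(x_{2i},x_{2j})$, $x_{1m}=x_{2m}$ for $m\ne i,j$, and $\vec y_1=\vec y_2$; (ii) for some $i<j$ with $(y_{2j}-y_{2i})(x_{2j}-x_{2i})\le 0$: $(y_{1i},y_{1j})\prec(y_{2i},y_{2j})$, $y_{1m}=y_{2m}$ for $m\ne i,j$, and $\vec x_1=\vec x_2$. The reverse-coupled weakly sub-sup majorization order is generated in the same way (by finite chains) by $\stackrel{rc}{\prec}$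 together with the relations (iii) $x_{1i}\le x_{2i}$ for all $i$, and $\vec y_1=\vec y_2$; (iv) $y_{1i}\ge y_{2i}$ for all $i$, and $\vec x_1=\vec x_2$. Theorem. Let $\vec\alpha_1,\vec\alpha_2$ be vectors in $\mathbb R^n$ with positive components. (a) Let $\vec p_1,\vec p_2\in(0,1)^n$. If $(\vec\alpha_1,\log\vec p_1)$ is below $(\vec\alpha_2,\log\vec p_2)$ in the reverse-coupled weakly sub-sup majorization order, then $\mathcal N_{\vec\alpha_1,\vec p_1}\le_{st}\mathcal N_{\vec\alpha_2,\vec p_2}$. (b) Let $\vec\beta_1,\vec\beta_2\in(0,\infty)^n$. If $(\vec\alpha_1,\log\vec\beta_1)$ is below $(\vec\alpha_2,\log\vec\beta_2)$ in the reverse-coupled weakly sub-sup majorization order, then $\mathcal G_{\vec\alpha_1,\vec\beta_1}\le_{st}\mathcal G_{\vec\alpha_2,\vec\beta_2}$. -/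

import Mathlib

open MeasureTheory ProbabilityTheory

noncomputable section

/-- The components of `x` arranged in increasing order. -/
def incrArr {n : ℕ} (x : Fin n → ℝ) : Fin n → ℝ := x ∘ Tuple.sort x

/-- The components of `x` arranged in decreasing order. -/
def decrArr {n : ℕ} (x : Fin n → ℝ) : Fin n → ℝ := fun i => incrArr x i.rev

/-- `x` is weakly majorized by `y` from below: for `k = 1, …, n`, the sum of the `k` largest
components of `x` is at most the sum of the `k` largest components of `y`. -/
def WeakMajBelow {n : ℕ} (x y : Fin n → ℝ) : Prop :=
  ∀ k : Fin n, ∑ i ∈ Finset.Iic k, decrArr x i ≤ ∑ i ∈ Finset.Iic k, decrArr y i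

/-- `x` is majorized by `y`. -/
def Maj {n : ℕ} (x y : Fin n → ℝ) : Prop :=
  WeakMajBelow x y ∧ ∑ i, x i = ∑ i, y i

/-- Pairs of vectors in `ℝⁿ`. -/
abbrev VecPair (n : ℕ) : Type := (Fin n → ℝ) × (Fin n → ℝ)

/-- Equality of pairs of vectors up to a simultaneous permutation of the coordinates. -/
def ArrEq {n : ℕ} (a b : VecPair n) : Prop :=
  ∃ π : Equiv.Perm (Fin n), a.1 = b.1 ∘ π ∧ a.2 = b.2 ∘ π

/-- The components `i`, `j` of the two vectors of the pair `b` are reversely ordered. -/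
def ReversePair {n : ℕ} (b : VecPair n) (i j : Fin n) : Prop :=
  (b.2 j - b.2 i) * (b.1 j - b.1 i) ≤ 0

/-- Relation (i): the first vectors differ only in two components, which are majorized, the pair
`b` being reversely ordered there; the second vectors agree. -/
def RelFst {n : ℕ} (a b : VecPair n) : Prop :=
  ∃ i j : Fin n, i < j ∧ ReversePair b i j ∧
    Maj ![a.1 i, a.1 j] ![b.1 i, b.1 j] ∧
    (∀ m, m ≠ i → m ≠ j → a.1 m = b.1 m) ∧ a.2 = b.2

/-- Relation (ii): the same with the two vectors of each pair exchanged. -/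
def RelSnd {n : ℕ} (a b : VecPair n) : Prop :=
  ∃ i j : Fin n, i < j ∧ ReversePair b i j ∧
    Maj ![a.2 i, a.2 j] ![b.2 i, b.2 j] ∧
    (∀ m, m ≠ i → m ≠ j → a.2 m = b.2 m) ∧ a.1 = b.1

/-- Relation (iii): the first vector increases. -/
def RelIncrFst {n : ℕ} (a b : VecPair n) : Prop :=
  (∀ i, a.1 i ≤ b.1 i) ∧ a.2 = b.2

/-- Relation (iv): the second vector decreases. -/
def RelDecrSnd {n : ℕ} (a b : VecPair n) : Prop :=
  (∀ i, b.2 i ≤ a.2 i) ∧ a.1 = b.1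

/-- The reverse-coupled majorization order: finite chains of relations (i) and (ii) between pairs
of vectors, which are considered modulo simultaneous permutations of the coordinates. -/
def RCMaj {n : ℕ} : VecPair n → VecPair n → Prop :=
  Relation.ReflTransGen fun a b => ArrEq a b ∨ RelFst a b ∨ RelSnd a b

/-- The reverse-coupled weakly sub-sup majorization order, generated by `RCMaj` and the
relations (iii) and (iv). -/
def WeakRCMaj {n : ℕ} : VecPair n → VecPair n → Prop :=
  Relation.ReflTransGen fun a b => RCMaj a b ∨ RelIncrFst a b ∨ RelDecrSnd a b

/-- The negative binomial distribution with shape parameter `α` and success probability `p`, as a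
distribution on `ℝ` carried by the natural numbers. -/
def negBinMeasure (α p : ℝ) : Measure ℝ :=
  Measure.sum fun k : ℕ =>
    ENNReal.ofReal (Ring.choose ((k : ℝ) + α - 1) k * p ^ α * (1 - p) ^ k) •
      Measure.dirac (k : ℝ)

/-- The distribution of the sum of independent real random variables with distributions `μ i`. -/
def sumLaw {n : ℕ} (μ : Fin n → Measure ℝ) : Measure ℝ :=
  (Measure.pi μ).map fun x => ∑ i, x i

/-- The distribution of a sum of independent negative binomial random variables. -/
def negBinConv {n : ℕ} (α p : Fin n → ℝ) : Measure ℝ :=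
  sumLaw fun i => negBinMeasure (α i) (p i)

/-- The distribution of a sum of independent gamma random variables with shape parameters `α i`
and densities proportional to `t ^ (α i - 1) * exp (-(β i * t))` on the positive half-line. -/
def gammaConv {n : ℕ} (α β : Fin n → ℝ) : Measure ℝ :=
  sumLaw fun i => gammaMeasure (α i) (β i)

/-- The usual stochastic order between distributions on `ℝ`: there is a random pair `(X, Z)`, with
joint distribution `γ`, such that `X` has distribution `μ`, `Z` is almost surely nonnegative, and
`X + Z` has distribution `ν`. -/
def StochLE (μ ν : Measure ℝ) : Prop :=
  ∃ γ : Measure (ℝ × ℝ), IsProbabilityMeasure γ ∧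
    γ.map (fun w => w.1) = μ ∧ (∀ᵐ w ∂γ, 0 ≤ w.2) ∧ γ.map (fun w => w.1 + w.2) = ν

end

/-!
Each member `(α, y)` of a chain carries the law of a sum of independent negative binomial variables
with shapes `α i` and success probabilities `exp (y i)`, and every step of a chain increases the
distribution stochastically, that is, decreases the distribution function. Convolution preserves
this order, so only the one or two summands that change have to be compared.

* A larger shape adds an independent nonnegative variable, because the negative binomial
  distributions with a fixed success probability form a convolution semigroup (`nb_conv_nb`).
* A smaller success probability increases the variable: the derivative of the distribution function
  has an explicit generating function with nonnegative coefficients (`nb_cdfle_of_le_log`).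
* For equal shapes and a fixed product `p * p'` of success probabilities, the generating function
  of the derivative of the distribution function is a multiple of
  `X * ((1 - (1 - p) * X) * (1 - (1 - p') * X)) ^ (-(a + 1))`. Its coefficients are nonnegative, so
  the sum increases when `p` and `p'` are spread (`nb_conv_nb_cdfle_of_spread`).
* Under reverse ordering, unequal shapes are reduced to these cases by the semigroup property: the
  surplus shape splits off as an independent summand, whose success probability decreases in either
  kind of majorization step (`nb_conv_nb_cdfle_of_shapes`, `nb_conv_nb_cdfle_of_logs`).

A chain may pass through pairs with negative shapes or with success probabilities above `1`.
Replacing `α i` by `max (α i) 0` and `y i` by `min (y i) 0` turns majorization into weak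
majorization and respects the reverse ordering, so each step can be compared after this truncation,
with the unit mass at `0` as the law of a degenerate summand (`truncLaw`).

All relations are invariant under a shift of the second vector. For gamma variables the chain is
therefore shifted by `log N`, so that the success probabilities become `β i / N`. Divided by `N`,
the negative binomial sums converge weakly to the gamma sums by Lévy's theorem
(`tendsto_charFun_nb`), and the order passes to the limit (`CDFLE.of_tendsto`). The coupling
required by `StochLE` is the one by quantile functions (`StochLE.of_cdfle`).
-/

noncomputable section

open Set Filter Topology

/-! ### The stochastic order and distribution functions -/

/-- The usual stochastic order, expressed by distribution functions. -/
def CDFLE (μ ν : Measure ℝ) : Prop :=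
  ∀ x : ℝ, ν (Iic x) ≤ μ (Iic x)

lemma CDFLE.refl (μ : Measure ℝ) : CDFLE μ μ := fun _ => le_rfl

lemma CDFLE.trans {μ ν ρ : Measure ℝ} (h₁ : CDFLE μ ν) (h₂ : CDFLE ν ρ) : CDFLE μ ρ :=
  fun x => (h₂ x).trans (h₁ x)

lemma conv_apply_Iic (μ ν : Measure ℝ) [SFinite μ] [SFinite ν] (x : ℝ) :
    (μ ∗ ν) (Iic x) = ∫⁻ y, μ (Iic (x - y)) ∂ν := by
  rw [Measure.conv, Measure.map_apply (by fun_prop) measurableSet_Iic,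
    Measure.prod_apply_symm (measurableSet_Iic.preimage (by fun_prop))]
  refine lintegral_congr fun y => congrArg μ ?_
  ext z
  simp [le_sub_iff_add_le]

lemma CDFLE.conv_right {μ ν : Measure ℝ} [SFinite μ] [SFinite ν] (h : CDFLE μ ν)
    (ρ : Measure ℝ) [SFinite ρ] : CDFLE (μ ∗ ρ) (ν ∗ ρ) := by
  intro x
  rw [conv_apply_Iic, conv_apply_Iic]
  exact lintegral_mono fun y => h (x - y)

lemma CDFLE.conv {μ ν μ' ν' : Measure ℝ} [SFinite μ] [SFinite ν] [SFinite μ'] [SFinite ν']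
    (h : CDFLE μ ν) (h' : CDFLE μ' ν') : CDFLE (μ ∗ μ') (ν ∗ ν') := by
  refine (h.conv_right μ').trans ?_
  rw [Measure.conv_comm ν, Measure.conv_comm ν]
  exact h'.conv_right ν

lemma CDFLE.map_mul_const {μ ν : Measure ℝ} (h : CDFLE μ ν) {c : ℝ} (hc : 0 < c) :
    CDFLE (μ.map (c * ·)) (ν.map (c * ·)) := by
  intro x
  have hpre : (c * ·) ⁻¹' Iic x = Iic (x / c) := by
    ext y
    simp [le_div_iff₀ hc, mul_comm]
  rw [Measure.map_apply (by fun_prop) measurableSet_Iic,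
    Measure.map_apply (by fun_prop) measurableSet_Iic, hpre]
  exact h _

/-- The order passes to weak limits: at a point `x`, compare the open half-line `Iio y` and the
closed half-line `Iic y` for `y > x` by the portmanteau theorem, and let `y` decrease to `x`. -/
lemma CDFLE.of_tendsto {μs νs : ℕ → ProbabilityMeasure ℝ} {μ ν : ProbabilityMeasure ℝ}
    (hμ : Tendsto μs atTop (𝓝 μ)) (hν : Tendsto νs atTop (𝓝 ν))
    (h : ∀ᶠ N in atTop, CDFLE (μs N : Measure ℝ) (νs N)) : CDFLE (μ : Measure ℝ) ν := by
  intro x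
  have key : ∀ y, x < y → (ν : Measure ℝ) (Iic x) ≤ (μ : Measure ℝ) (Iic y) := by
    intro y hy
    calc (ν : Measure ℝ) (Iic x) ≤ (ν : Measure ℝ) (Iio y) :=
          measure_mono (Iic_subset_Iio.2 hy)
      _ ≤ liminf (fun N => (νs N : Measure ℝ) (Iio y)) atTop :=
          ProbabilityMeasure.le_liminf_measure_open_of_tendsto hν isOpen_Iio
      _ ≤ limsup (fun N => (νs N : Measure ℝ) (Iio y)) atTop := liminf_le_limsup
      _ ≤ limsup (fun N => (μs N : Measure ℝ) (Iic y)) atTop := by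
          refine limsup_le_limsup ?_
          filter_upwards [h] with N hN
          exact (measure_mono Iio_subset_Iic_self).trans (hN y)
      _ ≤ (μ : Measure ℝ) (Iic y) :=
          ProbabilityMeasure.limsup_measure_closed_le_of_tendsto hμ isClosed_Iic
  have hlim : Tendsto (fun y => (μ : Measure ℝ) (Iic y)) (𝓝[>] x)
      (𝓝 ((μ : Measure ℝ) (Iic x))) := by
    have hcdf := (cdf (μ : Measure ℝ)).right_continuous x
    have := ENNReal.tendsto_ofReal (hcdf.mono Ioi_subset_Ici_self).tendsto
    simpa only [ofReal_cdf] using this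
  refine ge_of_tendsto hlim ?_
  filter_upwards [self_mem_nhdsWithin] with y hy using key y hy

/-! ### The quantile coupling -/

/-- The (lower) quantile function of a probability measure on `ℝ`. -/
def quantile (μ : Measure ℝ) (u : ℝ) : ℝ :=
  sInf {x | u ≤ cdf μ x}

lemma quantile_set_nonempty (μ : Measure ℝ) {u : ℝ} (hu : u ∈ Ioo (0 : ℝ) 1) :
    {x | u ≤ cdf μ x}.Nonempty := by
  obtain ⟨x, hx⟩ := ((tendsto_cdf_atTop μ).eventually (eventually_gt_nhds hu.2)).exists
  exact ⟨x, hx.le⟩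

lemma quantile_set_bddBelow (μ : Measure ℝ) {u : ℝ} (hu : u ∈ Ioo (0 : ℝ) 1) :
    BddBelow {x | u ≤ cdf μ x} := by
  obtain ⟨y, hy⟩ := ((tendsto_cdf_atBot μ).eventually (eventually_lt_nhds hu.1)).exists
  refine ⟨y, fun x hx => ?_⟩
  by_contra! hlt
  exact absurd (hx.trans (monotone_cdf μ hlt.le)) (not_le.2 hy)

lemma quantile_le_iff (μ : Measure ℝ) {u : ℝ} (hu : u ∈ Ioo (0 : ℝ) 1) (x : ℝ) :
    quantile μ u ≤ x ↔ u ≤ cdf μ x := by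
  refine ⟨fun h => ?_, fun h => csInf_le (quantile_set_bddBelow μ hu) h⟩
  have hgt : ∀ y, x < y → u ≤ cdf μ y := by
    intro y hy
    obtain ⟨z, hz, hzy⟩ := exists_lt_of_csInf_lt (quantile_set_nonempty μ hu) (h.trans_lt hy)
    exact le_trans hz (monotone_cdf μ hzy.le)
  have hlim := (((cdf μ).right_continuous x).mono Ioi_subset_Ici_self).tendsto
  refine ge_of_tendsto hlim ?_
  filter_upwards [self_mem_nhdsWithin] with y hy using hgt y hy

lemma aemeasurable_quantile (μ : Measure ℝ) :
    AEMeasurable (quantile μ) (volume.restrict (Ioo (0 : ℝ) 1)) := by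
  refine aemeasurable_restrict_of_monotoneOn measurableSet_Ioo fun u hu v hv huv => ?_
  exact csInf_le_csInf (quantile_set_bddBelow μ hu) (quantile_set_nonempty μ hv)
    fun x hx => le_trans huv hx

/-- The quantile function pushes the uniform distribution forward to the given measure. -/
lemma map_quantile (μ : Measure ℝ) [IsProbabilityMeasure μ] :
    (volume.restrict (Ioo (0 : ℝ) 1)).map (quantile μ) = μ := by
  refine Measure.ext_of_Iic _ _ fun x => ?_
  have hset : quantile μ ⁻¹' Iic x =ᵐ[volume.restrict (Ioo (0 : ℝ) 1)] Iic (cdf μ x) := by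
    filter_upwards [ae_restrict_mem measurableSet_Ioo] with u hu
    exact propext (quantile_le_iff μ hu x)
  have hinter : Iic (cdf μ x) ∩ Ioc (0 : ℝ) 1 = Ioc 0 (cdf μ x) := by
    ext u
    have := cdf_le_one μ x
    simp only [mem_inter_iff, mem_Iic, mem_Ioc]
    grind
  rw [Measure.map_apply_of_aemeasurable (aemeasurable_quantile μ) measurableSet_Iic,
    measure_congr hset, Measure.restrict_congr_set Ioo_ae_eq_Ioc,
    Measure.restrict_apply measurableSet_Iic, hinter, Real.volume_Ioc, sub_zero, ofReal_cdf]

lemma StochLE.of_cdfle {μ ν : Measure ℝ} [IsProbabilityMeasure μ] [IsProbabilityMeasure ν]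
    (h : CDFLE μ ν) : StochLE μ ν := by
  set U : Measure ℝ := volume.restrict (Ioo (0 : ℝ) 1) with hU
  have hμ := aemeasurable_quantile μ
  have hν := aemeasurable_quantile ν
  have hγ : AEMeasurable (fun u => (quantile μ u, quantile ν u - quantile μ u)) U :=
    hμ.prodMk (hν.sub hμ)
  have : IsProbabilityMeasure U := ⟨by simp [hU]⟩
  refine ⟨U.map fun u => (quantile μ u, quantile ν u - quantile μ u),
    Measure.isProbabilityMeasure_map hγ, ?_, ?_, ?_⟩
  · rw [AEMeasurable.map_map_of_aemeasurable (by fun_prop) hγ]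
    exact map_quantile μ
  · rw [ae_map_iff hγ (measurableSet_le measurable_const measurable_snd)]
    filter_upwards [ae_restrict_mem measurableSet_Ioo] with u hu
    refine sub_nonneg.2 ((quantile_le_iff μ hu _).2 (((quantile_le_iff ν hu _).1 le_rfl).trans ?_))
    rw [cdf_eq_real, cdf_eq_real]
    exact ENNReal.toReal_mono (measure_ne_top _ _) (h _)
  · rw [AEMeasurable.map_map_of_aemeasurable (by fun_prop) hγ]
    have hsum : (fun w : ℝ × ℝ => w.1 + w.2) ∘
        (fun u => (quantile μ u, quantile ν u - quantile μ u)) = quantile ν := by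
      ext u
      simp
    rw [hsum]
    exact map_quantile ν

/-! ### Measures carried by the natural numbers -/

/-- The measure on `ℝ` carried by `ℕ` whose mass at `k` is the coefficient of `X ^ k` in the
generating function `f`. -/
def genMeasure (f : PowerSeries ℝ) : Measure ℝ :=
  Measure.sum fun k : ℕ => ENNReal.ofReal (PowerSeries.coeff k f) • Measure.dirac (k : ℝ)

lemma genMeasure_apply_Iic (f : PowerSeries ℝ) (x : ℝ) :
    genMeasure f (Iic x) =
      ∑' k : ℕ, if (k : ℝ) ≤ x then ENNReal.ofReal (PowerSeries.coeff k f) else 0 := by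
  rw [genMeasure, Measure.sum_apply _ measurableSet_Iic]
  refine tsum_congr fun k => ?_
  by_cases hk : (k : ℝ) ≤ x <;> simp [hk]

lemma genMeasure_apply_Iic_of_nonneg {f : PowerSeries ℝ} (hf : ∀ k, 0 ≤ PowerSeries.coeff k f)
    {x : ℝ} (hx : 0 ≤ x) :
    genMeasure f (Iic x) =
      ENNReal.ofReal (∑ k ∈ Finset.range (⌊x⌋₊ + 1), PowerSeries.coeff k f) := by
  rw [genMeasure_apply_Iic, tsum_eq_sum (s := Finset.range (⌊x⌋₊ + 1)),
    ENNReal.ofReal_sum_of_nonneg fun k _ => hf k]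
  · refine Finset.sum_congr rfl fun k hk => if_pos ?_
    exact (Nat.le_floor_iff hx).1 (Nat.lt_succ_iff.1 (Finset.mem_range.1 hk))
  · intro k hk
    refine if_neg fun h => hk ?_
    exact Finset.mem_range.2 (Nat.lt_succ_iff.2 (Nat.le_floor h))

lemma genMeasure_apply_Iic_of_neg (f : PowerSeries ℝ) {x : ℝ} (hx : x < 0) :
    genMeasure f (Iic x) = 0 := by
  rw [genMeasure_apply_Iic, ENNReal.tsum_eq_zero]
  exact fun k => if_neg fun h => absurd (h.trans_lt hx) (not_lt.2 k.cast_nonneg)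

lemma CDFLE.genMeasure {f g : PowerSeries ℝ} (hf : ∀ k, 0 ≤ PowerSeries.coeff k f)
    (hg : ∀ k, 0 ≤ PowerSeries.coeff k g)
    (h : ∀ K : ℕ, ∑ k ∈ Finset.range (K + 1), PowerSeries.coeff k g ≤
      ∑ k ∈ Finset.range (K + 1), PowerSeries.coeff k f) :
    CDFLE (genMeasure f) (genMeasure g) := by
  intro x
  rcases lt_or_ge x 0 with hx | hx
  · rw [genMeasure_apply_Iic_of_neg _ hx, genMeasure_apply_Iic_of_neg _ hx]
  · rw [genMeasure_apply_Iic_of_nonneg hf hx, genMeasure_apply_Iic_of_nonneg hg hx]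
    exact ENNReal.ofReal_le_ofReal (h _)

lemma charFun_genMeasure {f : PowerSeries ℝ} (hf : ∀ k, 0 ≤ PowerSeries.coeff k f) (t : ℝ) :
    charFun (genMeasure f) t =
      ∑' k : ℕ, ((PowerSeries.coeff k f : ℝ) : ℂ) * Complex.exp (t * Complex.I) ^ k := by
  rw [charFun_apply_real, genMeasure, integral_sum_dirac fun _ => ENNReal.ofReal_ne_top]
  refine tsum_congr fun k => ?_
  rw [ENNReal.toReal_ofReal (hf k), Complex.real_smul, ← Complex.exp_nat_mul]
  push_cast
  ring_nf

lemma isProbabilityMeasure_genMeasure {f : PowerSeries ℝ} (hf : ∀ k, 0 ≤ PowerSeries.coeff k f)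
    (h : HasSum (fun k => PowerSeries.coeff k f) 1) : IsProbabilityMeasure (genMeasure f) := by
  constructor
  rw [genMeasure, Measure.sum_apply _ MeasurableSet.univ]
  simp only [Measure.smul_apply, measure_univ, smul_eq_mul, mul_one]
  rw [← ENNReal.ofReal_tsum_of_nonneg hf h.summable, h.tsum_eq, ENNReal.ofReal_one]

lemma coeff_mul_nonneg {f g : PowerSeries ℝ} (hf : ∀ k, 0 ≤ PowerSeries.coeff k f)
    (hg : ∀ k, 0 ≤ PowerSeries.coeff k g) (k : ℕ) : 0 ≤ PowerSeries.coeff k (f * g) := by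
  rw [PowerSeries.coeff_mul]
  exact Finset.sum_nonneg fun p _ => mul_nonneg (hf _) (hg _)

lemma hasSum_coeff_mul {f g : PowerSeries ℝ} {a b : ℝ}
    (h : HasSum (fun k => PowerSeries.coeff k f) a)
    (h' : HasSum (fun k => PowerSeries.coeff k g) b) :
    HasSum (fun k => PowerSeries.coeff k (f * g)) (a * b) := by
  simp only [PowerSeries.coeff_mul]
  rw [← h.tsum_eq, ← h'.tsum_eq,
    tsum_mul_tsum_eq_tsum_sum_antidiagonal_of_summable_norm h.summable.norm h'.summable.norm]
  exact (summable_norm_sum_mul_antidiagonal_of_summable_norm h.summable.norm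
    h'.summable.norm).of_norm.hasSum

/-- Generating functions multiply under convolution. -/
lemma genMeasure_conv_genMeasure {f g : PowerSeries ℝ} (hf : ∀ k, 0 ≤ PowerSeries.coeff k f)
    (hg : ∀ k, 0 ≤ PowerSeries.coeff k g) (h : HasSum (fun k => PowerSeries.coeff k f) 1)
    (h' : HasSum (fun k => PowerSeries.coeff k g) 1) :
    genMeasure f ∗ genMeasure g = genMeasure (f * g) := by
  have hfg := coeff_mul_nonneg hf hg
  have := isProbabilityMeasure_genMeasure hf h
  have := isProbabilityMeasure_genMeasure hg h'
  have := isProbabilityMeasure_genMeasure hfg (by simpa using hasSum_coeff_mul h h')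
  refine Measure.ext_of_charFun (funext fun t => ?_)
  have hz : ‖Complex.exp (t * Complex.I)‖ = 1 := Complex.norm_exp_ofReal_mul_I t
  have hs : ∀ {u : PowerSeries ℝ}, (∀ k, 0 ≤ PowerSeries.coeff k u) →
      HasSum (fun k => PowerSeries.coeff k u) 1 →
      Summable fun k => ‖((PowerSeries.coeff k u : ℝ) : ℂ) * Complex.exp (t * Complex.I) ^ k‖ := by
    intro u hu hu'
    simpa [hz, abs_of_nonneg (hu _)] using hu'.summable
  rw [charFun_conv, charFun_genMeasure hf, charFun_genMeasure hg, charFun_genMeasure hfg,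
    tsum_mul_tsum_eq_tsum_sum_antidiagonal_of_summable_norm (hs hf h) (hs hg h')]
  refine tsum_congr fun k => ?_
  rw [PowerSeries.coeff_mul]
  push_cast
  rw [Finset.sum_mul]
  refine Finset.sum_congr rfl fun p hp => ?_
  rw [← Finset.HasAntidiagonal.mem_antidiagonal.1 hp]
  ring

/-- The partial sums of the coefficients of `(1 - X) * g` telescope. -/
lemma sum_range_coeff_one_sub_X_mul (g : PowerSeries ℝ) (K : ℕ) :
    ∑ k ∈ Finset.range (K + 1), PowerSeries.coeff k ((1 - PowerSeries.X) * g) =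
      PowerSeries.coeff K g := by
  have h : (1 - PowerSeries.X) * g = g - PowerSeries.X * g := by ring
  induction K with
  | zero => simp [h]
  | succ K ih => rw [Finset.sum_range_succ, ih, h, map_sub, PowerSeries.coeff_succ_X_mul]; ring

/-! ### The binomial series with negative exponent -/

lemma multichoose_eq_eval_div (a : ℝ) (k : ℕ) :
    Ring.multichoose a k = (ascPochhammer ℝ k).eval a / k.factorial := by
  have h := Ring.factorial_nsmul_multichoose_eq_ascPochhammer a k
  rw [Polynomial.ascPochhammer_smeval_eq_eval, nsmul_eq_mul] at h
  rw [← h, mul_div_cancel_left₀ _ (by exact_mod_cast k.factorial_ne_zero)]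

lemma multichoose_nonneg {a : ℝ} (ha : 0 ≤ a) (k : ℕ) : 0 ≤ Ring.multichoose a k := by
  rw [multichoose_eq_eval_div]
  refine div_nonneg ?_ (Nat.cast_nonneg _)
  rcases ha.eq_or_lt with rfl | ha
  · rw [ascPochhammer_eval_zero]
    split_ifs <;> norm_num
  · exact (ascPochhammer_pos k a ha).le

lemma succ_mul_multichoose_succ (a : ℝ) (k : ℕ) :
    ((k : ℝ) + 1) * Ring.multichoose a (k + 1) = a * Ring.multichoose (a + 1) k := by
  rw [multichoose_eq_eval_div, multichoose_eq_eval_div, ascPochhammer_succ_left, Nat.factorial_succ]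
  have : (k.factorial : ℝ) ≠ 0 := by exact_mod_cast k.factorial_ne_zero
  have : (k : ℝ) + 1 ≠ 0 := by positivity
  simp only [Polynomial.eval_mul, Polynomial.eval_X, Polynomial.eval_comp, Polynomial.eval_add,
    Polynomial.eval_one]
  push_cast
  field_simp

/-- The power series `(1 - q X) ^ (-a)`. -/
def negBinSeries (a q : ℝ) : PowerSeries ℝ :=
  PowerSeries.mk fun k => Ring.multichoose a k * q ^ k

lemma coeff_negBinSeries (a q : ℝ) (k : ℕ) :
    PowerSeries.coeff k (negBinSeries a q) = Ring.multichoose a k * q ^ k :=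
  PowerSeries.coeff_mk _ _

lemma coeff_negBinSeries_nonneg {a q : ℝ} (ha : 0 ≤ a) (hq : 0 ≤ q) (k : ℕ) :
    0 ≤ PowerSeries.coeff k (negBinSeries a q) := by
  rw [coeff_negBinSeries]
  exact mul_nonneg (multichoose_nonneg ha k) (pow_nonneg hq k)

lemma one_sub_mul_negBinSeries (a q : ℝ) :
    (1 - PowerSeries.C q * PowerSeries.X) * negBinSeries (a + 1) q = negBinSeries a q := by
  have h : (1 - PowerSeries.C q * PowerSeries.X) * negBinSeries (a + 1) q =
      negBinSeries (a + 1) q - PowerSeries.C q * (PowerSeries.X * negBinSeries (a + 1) q) := by ring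
  ext k
  rw [h, map_sub, PowerSeries.coeff_C_mul]
  cases k with
  | zero => simp [coeff_negBinSeries]
  | succ k =>
    rw [PowerSeries.coeff_succ_X_mul, coeff_negBinSeries, coeff_negBinSeries, coeff_negBinSeries,
      Ring.multichoose_succ_succ]
    ring

/-- Differentiation of `(1 - q X) ^ (-a)` with respect to `q`, coefficient by coefficient. -/
lemma hasDerivAt_coeff_negBinSeries (a : ℝ) {q : ℝ → ℝ} {q' v : ℝ} (hq : HasDerivAt q q' v)
    (k : ℕ) :
    HasDerivAt (fun w => PowerSeries.coeff k (negBinSeries a (q w)))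
      (PowerSeries.coeff k
        (PowerSeries.C (a * q') * (PowerSeries.X * negBinSeries (a + 1) (q v)))) v := by
  simp only [coeff_negBinSeries, PowerSeries.coeff_C_mul]
  cases k with
  | zero => simpa using hasDerivAt_const v (1 : ℝ)
  | succ k =>
    rw [PowerSeries.coeff_succ_X_mul, coeff_negBinSeries]
    refine ((hq.pow (k + 1)).const_mul (Ring.multichoose a (k + 1))).congr_deriv ?_
    push_cast
    linear_combination (q v ^ k * q') * succ_mul_multichoose_succ a k

lemma hasDerivAt_coeff_mul {f g : ℝ → PowerSeries ℝ} {f' g' : PowerSeries ℝ} {v : ℝ}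
    (hf : ∀ k, HasDerivAt (fun w => PowerSeries.coeff k (f w)) (PowerSeries.coeff k f') v)
    (hg : ∀ k, HasDerivAt (fun w => PowerSeries.coeff k (g w)) (PowerSeries.coeff k g') v)
    (k : ℕ) :
    HasDerivAt (fun w => PowerSeries.coeff k (f w * g w))
      (PowerSeries.coeff k (f' * g v + f v * g')) v := by
  simp only [map_add, PowerSeries.coeff_mul, ← Finset.sum_add_distrib]
  exact HasDerivAt.fun_sum fun p _ => (hf p.1).mul (hg p.2)

/-! ### Negative binomial distributions -/

/-- The probability generating function of the negative binomial distribution with shape parameter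
`a` and success probability `exp v`. -/
def nbGen (a v : ℝ) : PowerSeries ℝ :=
  PowerSeries.C (Real.exp (a * v)) * negBinSeries a (1 - Real.exp v)

/-- The negative binomial distribution, parametrized by its shape `a` and the logarithm `v` of its
success probability. The boundary values `a = 0` and `v = 0` are allowed and give the unit mass
at `0`. -/
def nb (a v : ℝ) : Measure ℝ :=
  genMeasure (nbGen a v)

lemma negBinMeasure_eq_nb (a : ℝ) {p : ℝ} (hp : 0 < p) :
    negBinMeasure a p = nb a (Real.log p) := by
  unfold negBinMeasure nb genMeasure
  congr 1
  ext1 k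
  rw [nbGen, PowerSeries.coeff_C_mul, coeff_negBinSeries, Real.exp_log hp, Ring.multichoose_eq,
    mul_comm a, ← Real.rpow_def_of_pos hp, add_comm a]
  ring_nf

lemma coeff_nbGen_nonneg {a v : ℝ} (ha : 0 ≤ a) (hv : v ≤ 0) (k : ℕ) :
    0 ≤ PowerSeries.coeff k (nbGen a v) := by
  rw [nbGen, PowerSeries.coeff_C_mul]
  exact mul_nonneg (Real.exp_pos _).le
    (coeff_negBinSeries_nonneg ha (sub_nonneg.2 (Real.exp_le_one_iff.2 hv)) k)

lemma hasSum_negBinSeries_mul_pow (a : ℝ) {q : ℝ} {z : ℂ} (hz : ‖q * z‖ < 1) :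
    HasSum (fun k => ((PowerSeries.coeff k (negBinSeries a q) : ℝ) : ℂ) * z ^ k)
      (1 / (1 - q * z) ^ (a : ℂ)) := by
  have h := (Complex.one_div_one_sub_cpow_hasFPowerSeriesOnBall_zero a).hasSum
    (y := q * z) (by
      rw [mem_eball_zero_iff, ← ofReal_norm]
      exact ENNReal.ofReal_lt_one.2 hz)
  simp only [FormalMultilinearSeries.ofScalars_apply_eq, zero_add, smul_eq_mul] at h
  refine h.congr_fun fun k => ?_
  rw [coeff_negBinSeries, Ring.multichoose_eq]
  push_cast [Complex.ofReal_choose]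
  ring

lemma norm_one_sub_exp_mul_lt_one {v : ℝ} (hv : v ≤ 0) {z : ℂ} (hz : ‖z‖ = 1) :
    ‖((1 - Real.exp v : ℝ) : ℂ) * z‖ < 1 := by
  rw [norm_mul, hz, mul_one, Complex.norm_real, Real.norm_eq_abs,
    abs_of_nonneg (sub_nonneg.2 (Real.exp_le_one_iff.2 hv))]
  linarith [Real.exp_pos v]

lemma hasSum_nbGen_mul_pow (a : ℝ) {v : ℝ} (hv : v ≤ 0) {z : ℂ} (hz : ‖z‖ = 1) :
    HasSum (fun k => ((PowerSeries.coeff k (nbGen a v) : ℝ) : ℂ) * z ^ k)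
      (Real.exp (a * v) * (1 / (1 - ((1 - Real.exp v : ℝ) : ℂ) * z) ^ (a : ℂ))) := by
  refine ((hasSum_negBinSeries_mul_pow a (norm_one_sub_exp_mul_lt_one hv hz)).mul_left
    ((Real.exp (a * v) : ℝ) : ℂ)).congr_fun fun k => ?_
  rw [nbGen, PowerSeries.coeff_C_mul]
  push_cast
  ring

lemma hasSum_coeff_nbGen (a : ℝ) {v : ℝ} (hv : v ≤ 0) :
    HasSum (fun k => PowerSeries.coeff k (nbGen a v)) 1 := by
  have h := hasSum_nbGen_mul_pow a hv (z := 1) norm_one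
  simp only [one_pow, mul_one] at h
  have he : ((Real.exp (a * v) : ℝ) : ℂ) * (1 / (1 - ((1 - Real.exp v : ℝ) : ℂ)) ^ (a : ℂ)) =
      ((1 : ℝ) : ℂ) := by
    rw [show (1 : ℂ) - ((1 - Real.exp v : ℝ) : ℂ) = ((Real.exp v : ℝ) : ℂ) by push_cast; ring,
      ← Complex.ofReal_cpow (Real.exp_pos v).le, ← Real.exp_mul, mul_comm v a]
    push_cast
    exact mul_one_div_cancel (Complex.exp_ne_zero _)
  rw [he] at h
  exact_mod_cast h

lemma isProbabilityMeasure_nb {a v : ℝ} (ha : 0 ≤ a) (hv : v ≤ 0) :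
    IsProbabilityMeasure (nb a v) :=
  isProbabilityMeasure_genMeasure (coeff_nbGen_nonneg ha hv) (hasSum_coeff_nbGen a hv)

lemma charFun_nb {a v : ℝ} (ha : 0 ≤ a) (hv : v ≤ 0) (t : ℝ) :
    charFun (nb a v) t = Real.exp (a * v) *
      (1 / (1 - ((1 - Real.exp v : ℝ) : ℂ) * Complex.exp (t * Complex.I)) ^ (a : ℂ)) := by
  rw [nb, charFun_genMeasure (coeff_nbGen_nonneg ha hv)]
  exact (hasSum_nbGen_mul_pow a hv (Complex.norm_exp_ofReal_mul_I t)).tsum_eq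

/-- Negative binomial distributions with the same success probability form a convolution
semigroup in the shape parameter. -/
lemma nb_conv_nb {a b v : ℝ} (ha : 0 ≤ a) (hb : 0 ≤ b) (hv : v ≤ 0) :
    nb a v ∗ nb b v = nb (a + b) v := by
  have := isProbabilityMeasure_nb ha hv
  have := isProbabilityMeasure_nb hb hv
  have := isProbabilityMeasure_nb (add_nonneg ha hb) hv
  refine Measure.ext_of_charFun (funext fun t => ?_)
  have hne : 1 - ((1 - Real.exp v : ℝ) : ℂ) * Complex.exp (t * Complex.I) ≠ 0 := by
    intro h
    have := norm_one_sub_exp_mul_lt_one hv (Complex.norm_exp_ofReal_mul_I t)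
    rw [← sub_eq_zero.1 h, norm_one] at this
    exact lt_irrefl _ this
  rw [charFun_conv, charFun_nb ha hv, charFun_nb hb hv, charFun_nb (add_nonneg ha hb) hv,
    Complex.ofReal_add, Complex.cpow_add _ _ hne, add_mul, Real.exp_add]
  push_cast
  ring

/-- The unit mass at `0` lies below every negative binomial distribution. -/
lemma dirac_zero_cdfle_nb {a v : ℝ} (ha : 0 ≤ a) (hv : v ≤ 0) :
    CDFLE (Measure.dirac 0) (nb a v) := by
  intro x
  have := isProbabilityMeasure_nb ha hv
  rcases lt_or_ge x 0 with hx | hx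
  · rw [nb, genMeasure_apply_Iic_of_neg _ hx]
    exact bot_le
  · rw [Measure.dirac_apply' _ measurableSet_Iic, indicator_of_mem (mem_Iic.2 hx)]
    exact prob_le_one

lemma nb_cdfle_of_le_shape {a b v : ℝ} (ha : 0 ≤ a) (hab : a ≤ b) (hv : v ≤ 0) :
    CDFLE (nb a v) (nb b v) := by
  have hd : 0 ≤ b - a := sub_nonneg.2 hab
  have := isProbabilityMeasure_nb ha hv
  have := isProbabilityMeasure_nb hd hv
  have h := (CDFLE.refl (nb a v)).conv (dirac_zero_cdfle_nb hd hv)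
  rwa [nb_conv_nb ha hd hv, add_sub_cancel, Measure.conv_dirac_zero] at h

/-- A negative binomial variable increases stochastically when its success probability decreases:
the derivative in `v` of the distribution function at `K` is `a * exp (a * v)` times the
coefficient of `X ^ K` in `(1 - (1 - exp v) * X) ^ (-(a + 1))`. -/
lemma nb_cdfle_of_le_log {a v w : ℝ} (ha : 0 ≤ a) (hvw : v ≤ w) (hw : w ≤ 0) :
    CDFLE (nb a w) (nb a v) := by
  refine CDFLE.genMeasure (coeff_nbGen_nonneg ha hw) (coeff_nbGen_nonneg ha (hvw.trans hw))
    fun K => ?_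
  set F : ℝ → ℝ := fun u => ∑ k ∈ Finset.range (K + 1), PowerSeries.coeff k (nbGen a u) with hF
  have hderiv : ∀ u, HasDerivAt F (a * Real.exp (a * u) *
      PowerSeries.coeff K (negBinSeries (a + 1) (1 - Real.exp u))) u := by
    intro u
    have hE : HasDerivAt (fun u => Real.exp (a * u)) (Real.exp (a * u) * a) u := by
      simpa using ((hasDerivAt_id u).const_mul a).exp
    have hq : HasDerivAt (fun u => 1 - Real.exp u) (-Real.exp u) u := by
      simpa using (Real.hasDerivAt_exp u).const_sub 1
    have hterm : ∀ k, HasDerivAt (fun u => PowerSeries.coeff k (nbGen a u))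
        (a * Real.exp (a * u) * PowerSeries.coeff k
          ((1 - PowerSeries.X) * negBinSeries (a + 1) (1 - Real.exp u))) u := by
      intro k
      simp only [nbGen, PowerSeries.coeff_C_mul]
      refine (hE.mul (hasDerivAt_coeff_negBinSeries a hq k)).congr_deriv ?_
      rw [← one_sub_mul_negBinSeries, mul_assoc, ← PowerSeries.coeff_C_mul,
        ← PowerSeries.coeff_C_mul, ← PowerSeries.coeff_C_mul, ← map_add,
        ← PowerSeries.coeff_C_mul]
      congr 1
      simp only [map_mul, map_sub, map_neg, map_one]
      ring
    have := HasDerivAt.fun_sum (u := Finset.range (K + 1)) fun k _ => hterm k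
    rwa [← Finset.mul_sum, sum_range_coeff_one_sub_X_mul] at this
  refine monotoneOn_of_deriv_nonneg (D := Iic 0) (convex_Iic 0)
    (fun u _ => (hderiv u).continuousAt.continuousWithinAt)
    (fun u _ => (hderiv u).differentiableAt.differentiableWithinAt)
    (fun u hu => ?_) (hvw.trans hw) hw hvw
  rw [(hderiv u).deriv]
  have hu' : u ≤ 0 := mem_Iic.1 (interior_subset hu)
  exact mul_nonneg (mul_nonneg ha (Real.exp_pos _).le) (coeff_negBinSeries_nonneg (by linarith)
    (sub_nonneg.2 (Real.exp_le_one_iff.2 hu')) K)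

/-- For equal shape parameters and a fixed product of the success probabilities, spreading the
success probabilities increases the sum stochastically. With `p = exp u` and `p' = exp (s - u)`,
the derivative in `u` of the distribution function at `K` is a positive multiple of `p' - p` times
the coefficient of `X ^ K` in `X * ((1 - (1 - p) * X) * (1 - (1 - p') * X)) ^ (-(a + 1))`. -/
lemma nb_conv_nb_cdfle_of_spread {a s v w : ℝ} (ha : 0 ≤ a) (hvw : v ≤ w) (hw : w ≤ s - w)
    (hv : s - v ≤ 0) :
    CDFLE (nb a w ∗ nb a (s - w)) (nb a v ∗ nb a (s - v)) := by
  have hw0 : w ≤ 0 := by linarith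
  have hv0 : v ≤ 0 := by linarith
  have hsw0 : s - w ≤ 0 := by linarith
  have hnn : ∀ {u}, u ≤ 0 → ∀ k, 0 ≤ PowerSeries.coeff k (nbGen a u) :=
    fun hu => coeff_nbGen_nonneg ha hu
  have hsum : ∀ {u}, u ≤ 0 → HasSum (fun k => PowerSeries.coeff k (nbGen a u)) 1 :=
    fun hu => hasSum_coeff_nbGen a hu
  simp only [nb]
  rw [genMeasure_conv_genMeasure (hnn hw0) (hnn hsw0) (hsum hw0) (hsum hsw0),
    genMeasure_conv_genMeasure (hnn hv0) (hnn hv) (hsum hv0) (hsum hv)]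
  refine CDFLE.genMeasure (coeff_mul_nonneg (hnn hw0) (hnn hsw0))
    (coeff_mul_nonneg (hnn hv0) (hnn hv)) fun K => ?_
  set S : ℝ → PowerSeries ℝ := fun u =>
    negBinSeries a (1 - Real.exp u) * negBinSeries a (1 - Real.exp (s - u)) with hS
  set T : ℝ → PowerSeries ℝ := fun u =>
    negBinSeries (a + 1) (1 - Real.exp u) * negBinSeries (a + 1) (1 - Real.exp (s - u)) with hT
  have hgen : ∀ u, nbGen a u * nbGen a (s - u) = PowerSeries.C (Real.exp (a * s)) * S u := by
    intro u
    rw [show a * s = a * u + a * (s - u) by ring, Real.exp_add, map_mul, hS, nbGen, nbGen]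
    ring
  have hderiv : ∀ u, HasDerivAt (fun u => ∑ k ∈ Finset.range (K + 1), PowerSeries.coeff k (S u))
      (a * (Real.exp (s - u) - Real.exp u) * PowerSeries.coeff K (PowerSeries.X * T u)) u := by
    intro u
    have hq : HasDerivAt (fun u => 1 - Real.exp u) (-Real.exp u) u := by
      simpa using (Real.hasDerivAt_exp u).const_sub 1
    have hq' : HasDerivAt (fun u => 1 - Real.exp (s - u)) (Real.exp (s - u)) u := by
      simpa using (((hasDerivAt_id u).const_sub s).exp).const_sub 1
    have hterm : ∀ k, HasDerivAt (fun u => PowerSeries.coeff k (S u))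
        (a * (Real.exp (s - u) - Real.exp u) *
          PowerSeries.coeff k ((1 - PowerSeries.X) * (PowerSeries.X * T u))) u := by
      intro k
      refine (hasDerivAt_coeff_mul (hasDerivAt_coeff_negBinSeries a hq)
        (hasDerivAt_coeff_negBinSeries a hq') k).congr_deriv ?_
      rw [← PowerSeries.coeff_C_mul, ← one_sub_mul_negBinSeries a (1 - Real.exp u),
        ← one_sub_mul_negBinSeries a (1 - Real.exp (s - u)), hT]
      congr 1
      simp only [map_mul, map_sub, map_neg, map_one]
      ring
    have := HasDerivAt.fun_sum (u := Finset.range (K + 1)) fun k _ => hterm k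
    rwa [← Finset.mul_sum, sum_range_coeff_one_sub_X_mul] at this
  simp only [hgen, PowerSeries.coeff_C_mul]
  rw [← Finset.mul_sum, ← Finset.mul_sum]
  refine mul_le_mul_of_nonneg_left ?_ (Real.exp_pos _).le
  refine monotoneOn_of_deriv_nonneg (D := Icc v w) (convex_Icc v w)
    (fun u _ => (hderiv u).continuousAt.continuousWithinAt)
    (fun u _ => (hderiv u).differentiableAt.differentiableWithinAt)
    (fun u hu => ?_) (left_mem_Icc.2 hvw) (right_mem_Icc.2 hvw) hvw
  rw [(hderiv u).deriv]
  obtain ⟨hu₁, hu₂⟩ : u ∈ Icc v w := interior_subset hu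
  have hcoef : ∀ {r : ℝ}, r ≤ 0 → ∀ k,
      0 ≤ PowerSeries.coeff k (negBinSeries (a + 1) (1 - Real.exp r)) := fun hr =>
    coeff_negBinSeries_nonneg (by linarith) (sub_nonneg.2 (Real.exp_le_one_iff.2 hr))
  refine mul_nonneg (mul_nonneg ha (sub_nonneg.2 (Real.exp_le_exp.2 (by linarith)))) ?_
  refine coeff_mul_nonneg (fun k => ?_) (coeff_mul_nonneg (hcoef (by linarith))
    (hcoef (by linarith))) K
  rw [PowerSeries.coeff_X]
  split_ifs <;> norm_num

/-! ### Pairs of negative binomial variables -/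

/-- Shape parameter is moved, and possibly added, to the summand with the smaller success
probability. -/
lemma nb_conv_nb_cdfle_of_shapes {a b a' b' v w : ℝ} (ha : 0 ≤ a) (hb : 0 ≤ b) (hb' : 0 ≤ b')
    (haa' : a ≤ a') (hsum : a + b ≤ a' + b') (hvw : v ≤ w) (hw : w ≤ 0) :
    CDFLE (nb a v ∗ nb b w) (nb a' v ∗ nb b' w) := by
  have hv := hvw.trans hw
  have := isProbabilityMeasure_nb ha hv
  have := isProbabilityMeasure_nb hb hw
  have := isProbabilityMeasure_nb (ha.trans haa') hv
  have := isProbabilityMeasure_nb hb' hw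
  rcases le_total b b' with h | h
  · exact (nb_cdfle_of_le_shape ha haa' hv).conv (nb_cdfle_of_le_shape hb h hw)
  · -- The surplus shape `b - b'` moves from the second summand to the first one.
    have hd : 0 ≤ b - b' := sub_nonneg.2 h
    have := isProbabilityMeasure_nb hd hv
    have := isProbabilityMeasure_nb hd hw
    have := isProbabilityMeasure_nb (add_nonneg ha hd) hv
    have h₁ : CDFLE (nb a v ∗ nb b w) (nb (a + (b - b')) v ∗ nb b' w) := by
      have hsplit : nb b w = nb (b - b') w ∗ nb b' w := by
        rw [nb_conv_nb hd hb' hw, sub_add_cancel]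
      rw [hsplit, ← Measure.conv_assoc, ← nb_conv_nb ha hd hv]
      exact ((CDFLE.refl _).conv (nb_cdfle_of_le_log hd hvw hw)).conv_right _
    exact h₁.trans ((nb_cdfle_of_le_shape (add_nonneg ha hd) (by linarith) hv).conv_right _)

/-- For equal shape parameters, the logarithms of the success probabilities are spread, and
possibly decreased. -/
lemma nb_conv_nb_cdfle_of_logs_of_eq_shape {a v w v' w' : ℝ} (ha : 0 ≤ a) (hv : v ≤ 0)
    (hw : w ≤ 0) (hw' : w' ≤ 0) (hv'v : v' ≤ v) (hv'w : v' ≤ w) (hsum : v' + w' ≤ v + w) :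
    CDFLE (nb a v ∗ nb a w) (nb a v' ∗ nb a w') := by
  wlog hvw : v ≤ w generalizing v w with hswap
  · have := isProbabilityMeasure_nb ha hv
    have := isProbabilityMeasure_nb ha hw
    rw [Measure.conv_comm]
    exact hswap hw hv hv'w hv'v (by linarith) (le_of_not_ge hvw)
  have hv' := hv'v.trans hv
  have := isProbabilityMeasure_nb ha hv
  have := isProbabilityMeasure_nb ha hw
  have := isProbabilityMeasure_nb ha hv'
  have := isProbabilityMeasure_nb ha hw'
  rcases le_total w' w with h | h
  · exact (nb_cdfle_of_le_log ha hv'v hv).conv (nb_cdfle_of_le_log ha h hw)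
  · have hmid : v + w - w' ≤ 0 := by linarith
    have := isProbabilityMeasure_nb ha hmid
    have h₁ := nb_conv_nb_cdfle_of_spread (s := v + w) (v := v + w - w') (w := v) ha
      (by linarith) (by linarith) (by linarith)
    rw [add_sub_cancel_left, sub_sub_cancel] at h₁
    exact h₁.trans ((nb_cdfle_of_le_log ha (by linarith) hmid).conv_right _)

/-- The logarithms of the success probabilities are spread, and possibly decreased, the summand
with the larger shape parameter receiving the smaller success probability. -/
lemma nb_conv_nb_cdfle_of_logs {a b v w v' w' : ℝ} (hb : 0 ≤ b) (hba : b ≤ a) (hv : v ≤ 0)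
    (hw : w ≤ 0) (hw' : w' ≤ 0) (hv'v : v' ≤ v) (hv'w : v' ≤ w) (hsum : v' + w' ≤ v + w) :
    CDFLE (nb a v ∗ nb b w) (nb a v' ∗ nb b w') := by
  have hd : 0 ≤ a - b := sub_nonneg.2 hba
  have hv' := hv'v.trans hv
  have := isProbabilityMeasure_nb hb hv
  have := isProbabilityMeasure_nb hb hw
  have := isProbabilityMeasure_nb hb hv'
  have := isProbabilityMeasure_nb hb hw'
  have := isProbabilityMeasure_nb hd hv
  have := isProbabilityMeasure_nb hd hv'
  have hsplit : ∀ {u}, u ≤ 0 → nb a u = nb (a - b) u ∗ nb b u := fun hu => by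
    rw [nb_conv_nb hd hb hu, sub_add_cancel]
  rw [hsplit hv, hsplit hv', Measure.conv_assoc, Measure.conv_assoc]
  exact (nb_cdfle_of_le_log hd hv'v hv).conv
    (nb_conv_nb_cdfle_of_logs_of_eq_shape hb hv hw hw' hv'v hv'w hsum)

/-! ### Sums of independent variables -/

lemma isProbabilityMeasure_sumLaw {n : ℕ} {μ : Fin n → Measure ℝ}
    (hμ : ∀ i, IsProbabilityMeasure (μ i)) : IsProbabilityMeasure (sumLaw μ) :=
  Measure.isProbabilityMeasure_map (by fun_prop)

lemma charFun_sumLaw {n : ℕ} {μ : Fin n → Measure ℝ} (hμ : ∀ i, IsProbabilityMeasure (μ i))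
    (t : ℝ) : charFun (sumLaw μ) t = ∏ i, charFun (μ i) t := by
  rw [sumLaw, charFun_map_sum_pi_eq_prod, Finset.prod_apply]

lemma sumLaw_comp_perm {n : ℕ} {μ : Fin n → Measure ℝ} (hμ : ∀ i, IsProbabilityMeasure (μ i))
    (π : Equiv.Perm (Fin n)) : sumLaw (fun i => μ (π i)) = sumLaw μ := by
  have := isProbabilityMeasure_sumLaw hμ
  have := isProbabilityMeasure_sumLaw fun i => hμ (π i)
  refine Measure.ext_of_charFun (funext fun t => ?_)
  rw [charFun_sumLaw hμ, charFun_sumLaw fun i => hμ (π i)]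
  exact Equiv.prod_comp π fun i => charFun (μ i) t

lemma sumLaw_succ {n : ℕ} {μ : Fin (n + 1) → Measure ℝ} (hμ : ∀ i, IsProbabilityMeasure (μ i)) :
    sumLaw μ = μ 0 ∗ sumLaw fun i => μ i.succ := by
  have := isProbabilityMeasure_sumLaw hμ
  have := isProbabilityMeasure_sumLaw fun i : Fin n => hμ i.succ
  refine Measure.ext_of_charFun (funext fun t => ?_)
  rw [charFun_conv, charFun_sumLaw hμ, charFun_sumLaw fun i : Fin n => hμ i.succ,
    Fin.prod_univ_succ]

lemma sumLaw_eq_pair_conv {n : ℕ} {μ : Fin n → Measure ℝ} (hμ : ∀ i, IsProbabilityMeasure (μ i))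
    {i j : Fin n} (hij : i ≠ j) :
    sumLaw μ = (μ i ∗ μ j) ∗ sumLaw fun m => if m = i ∨ m = j then Measure.dirac 0 else μ m := by
  have hrest : ∀ m, IsProbabilityMeasure (if m = i ∨ m = j then Measure.dirac 0 else μ m) := by
    intro m
    split_ifs
    · infer_instance
    · exact hμ m
  have := isProbabilityMeasure_sumLaw hμ
  have := isProbabilityMeasure_sumLaw hrest
  refine Measure.ext_of_charFun (funext fun t => ?_)
  have hi : i ∈ Finset.univ.erase j := by simp [hij]
  rw [charFun_conv, charFun_conv, charFun_sumLaw hμ, charFun_sumLaw hrest,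
    ← Finset.mul_prod_erase _ _ (Finset.mem_univ j), ← Finset.mul_prod_erase _ _ hi,
    ← Finset.mul_prod_erase Finset.univ _ (Finset.mem_univ j), ← Finset.mul_prod_erase _ _ hi]
  have hprod : ∏ m ∈ (Finset.univ.erase j).erase i,
      charFun (if m = i ∨ m = j then Measure.dirac 0 else μ m) t =
      ∏ m ∈ (Finset.univ.erase j).erase i, charFun (μ m) t := by
    refine Finset.prod_congr rfl fun m hm => ?_
    simp only [Finset.mem_erase] at hm
    rw [if_neg (by tauto)]
  rw [hprod]
  simp
  ring

lemma CDFLE.sumLaw {n : ℕ} {μ ν : Fin n → Measure ℝ} (hμ : ∀ i, IsProbabilityMeasure (μ i))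
    (hν : ∀ i, IsProbabilityMeasure (ν i)) (h : ∀ i, CDFLE (μ i) (ν i)) :
    CDFLE (sumLaw μ) (sumLaw ν) := by
  induction n with
  | zero => rw [Subsingleton.elim μ ν]; exact CDFLE.refl _
  | succ n ih =>
    have := isProbabilityMeasure_sumLaw fun i : Fin n => hμ i.succ
    have := isProbabilityMeasure_sumLaw fun i : Fin n => hν i.succ
    rw [sumLaw_succ hμ, sumLaw_succ hν]
    exact (h 0).conv (ih (fun i => hμ i.succ) (fun i => hν i.succ) fun i => h i.succ)

lemma CDFLE.sumLaw_of_pair {n : ℕ} {μ ν : Fin n → Measure ℝ}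
    (hμ : ∀ i, IsProbabilityMeasure (μ i)) (hν : ∀ i, IsProbabilityMeasure (ν i))
    {i j : Fin n} (hij : i ≠ j) (hrest : ∀ m, m ≠ i → m ≠ j → μ m = ν m)
    (h : CDFLE (μ i ∗ μ j) (ν i ∗ ν j)) : CDFLE (_root_.sumLaw μ) (_root_.sumLaw ν) := by
  have heq : (fun m => if m = i ∨ m = j then Measure.dirac 0 else μ m) =
      fun m => if m = i ∨ m = j then Measure.dirac 0 else ν m := by
    ext1 m
    split_ifs with hm
    · rfl
    · exact hrest m (by tauto) (by tauto)
  have hprob : IsProbabilityMeasure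
      (_root_.sumLaw fun m => if m = i ∨ m = j then Measure.dirac 0 else ν m) := by
    refine isProbabilityMeasure_sumLaw fun m => ?_
    split_ifs
    · infer_instance
    · exact hν m
  rw [sumLaw_eq_pair_conv hμ hij, sumLaw_eq_pair_conv hν hij, heq]
  exact h.conv_right _

/-! ### Chains in the reverse-coupled order -/

lemma decrArr_zero_mem_and_le (x : Fin 2 → ℝ) :
    (∃ k, decrArr x 0 = x k) ∧ ∀ k, x k ≤ decrArr x 0 := by
  refine ⟨⟨_, rfl⟩, fun k => ?_⟩
  have h := Tuple.monotone_sort x (Fin.le_last ((Tuple.sort x).symm k))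
  simpa [decrArr, incrArr, Fin.rev_zero] using h

lemma Maj.pair {a b c d : ℝ} (h : Maj ![a, b] ![c, d]) :
    a ≤ max c d ∧ b ≤ max c d ∧ a + b = c + d := by
  have h0 := h.1 0
  rw [show Finset.Iic (0 : Fin 2) = {0} from rfl, Finset.sum_singleton, Finset.sum_singleton] at h0
  have hle := (decrArr_zero_mem_and_le ![a, b]).2
  obtain ⟨k, hk⟩ := (decrArr_zero_mem_and_le ![c, d]).1
  have hmax : decrArr ![c, d] 0 ≤ max c d := by
    rw [hk]
    fin_cases k <;> simp
  refine ⟨(hle 0).trans (h0.trans hmax), (hle 1).trans (h0.trans hmax), ?_⟩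
  simpa using h.2

/-- The sum of independent negative binomial variables attached to a pair of vectors, the second
one being shifted by `c`. Intermediate members of a chain may leave the admissible region: negative
shape parameters are replaced by `0`, and success probabilities above `1` by `1`. Both truncations
only delete summands, and they turn every step of a chain into a sequence of admissible steps. -/
def truncLaw {n : ℕ} (c : ℝ) (a : VecPair n) : Measure ℝ :=
  sumLaw fun i => nb (max (a.1 i) 0) (min (a.2 i - c) 0)

lemma isProbabilityMeasure_nb_trunc (a y : ℝ) : IsProbabilityMeasure (nb (max a 0) (min y 0)) :=
  isProbabilityMeasure_nb (le_max_right _ _) (min_le_right _ _)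

lemma truncLaw_eq_of_arrEq {n : ℕ} (c : ℝ) {a b : VecPair n} (h : ArrEq a b) :
    truncLaw c a = truncLaw c b := by
  obtain ⟨π, h₁, h₂⟩ := h
  simp only [truncLaw, h₁, h₂, Function.comp]
  exact sumLaw_comp_perm (fun i => isProbabilityMeasure_nb_trunc (b.1 i) (b.2 i - c)) π

/-- Relation (i) without the ordering of the two indices, and with the reverse ordering resolved. -/
lemma truncLaw_cdfle_of_fst {n : ℕ} (c : ℝ) {a b : VecPair n} {i j : Fin n} (hij : i ≠ j)
    (h1 : b.1 j ≤ b.1 i) (h2 : b.2 i ≤ b.2 j) (hmax : a.1 i ≤ b.1 i) (hmax' : a.1 j ≤ b.1 i)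
    (hsum : a.1 i + a.1 j = b.1 i + b.1 j)
    (hrest : ∀ m, m ≠ i → m ≠ j → a.1 m = b.1 m) (hy : a.2 = b.2) :
    CDFLE (truncLaw c a) (truncLaw c b) := by
  refine CDFLE.sumLaw_of_pair (fun _ => isProbabilityMeasure_nb_trunc _ _)
    (fun _ => isProbabilityMeasure_nb_trunc _ _) hij
    (fun m hi hj => by rw [hrest m hi hj, hy]) ?_
  rw [hy]
  refine nb_conv_nb_cdfle_of_shapes (le_max_right _ _) (le_max_right _ _) (le_max_right _ _)
    (max_le_max_right 0 hmax) ?_ (min_le_min_right 0 (sub_le_sub_right h2 c)) (min_le_right _ _)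
  grind

/-- Relation (ii) without the ordering of the two indices, and with the reverse ordering
resolved. -/
lemma truncLaw_cdfle_of_snd {n : ℕ} (c : ℝ) {a b : VecPair n} {i j : Fin n} (hij : i ≠ j)
    (h1 : b.1 j ≤ b.1 i) (hmin : b.2 i ≤ a.2 i) (hmin' : b.2 i ≤ a.2 j)
    (hsum : a.2 i + a.2 j = b.2 i + b.2 j)
    (hrest : ∀ m, m ≠ i → m ≠ j → a.2 m = b.2 m) (hx : a.1 = b.1) :
    CDFLE (truncLaw c a) (truncLaw c b) := by
  refine CDFLE.sumLaw_of_pair (fun _ => isProbabilityMeasure_nb_trunc _ _)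
    (fun _ => isProbabilityMeasure_nb_trunc _ _) hij
    (fun m hi hj => by rw [hrest m hi hj, hx]) ?_
  rw [hx]
  refine nb_conv_nb_cdfle_of_logs (le_max_right _ _) (max_le_max_right 0 h1) (min_le_right _ _)
    (min_le_right _ _) (min_le_right _ _) (min_le_min_right 0 (sub_le_sub_right hmin c))
    (min_le_min_right 0 (sub_le_sub_right hmin' c)) ?_
  grind

lemma ReversePair.cases {n : ℕ} {b : VecPair n} {i j : Fin n} (h : ReversePair b i j) :
    (b.1 j ≤ b.1 i ∧ b.2 i ≤ b.2 j) ∨ (b.1 i ≤ b.1 j ∧ b.2 j ≤ b.2 i) := by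
  rcases mul_nonpos_iff.1 h with ⟨h₁, h₂⟩ | ⟨h₁, h₂⟩
  · exact Or.inl ⟨sub_nonpos.1 h₂, sub_nonneg.1 h₁⟩
  · exact Or.inr ⟨sub_nonneg.1 h₂, sub_nonpos.1 h₁⟩

lemma truncLaw_cdfle_of_relFst {n : ℕ} (c : ℝ) {a b : VecPair n} (h : RelFst a b) :
    CDFLE (truncLaw c a) (truncLaw c b) := by
  obtain ⟨i, j, hij, hrev, hmaj, hrest, hy⟩ := h
  obtain ⟨hi, hj, hsum⟩ := hmaj.pair
  rcases hrev.cases with ⟨h₁, h₂⟩ | ⟨h₁, h₂⟩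
  · rw [max_eq_left h₁] at hi hj
    exact truncLaw_cdfle_of_fst c hij.ne h₁ h₂ hi hj hsum hrest hy
  · rw [max_eq_right h₁] at hi hj
    exact truncLaw_cdfle_of_fst c hij.ne' h₁ h₂ hj hi (by linarith)
      (fun m hj hi => hrest m hi hj) hy

lemma truncLaw_cdfle_of_relSnd {n : ℕ} (c : ℝ) {a b : VecPair n} (h : RelSnd a b) :
    CDFLE (truncLaw c a) (truncLaw c b) := by
  obtain ⟨i, j, hij, hrev, hmaj, hrest, hx⟩ := h
  obtain ⟨hi, hj, hsum⟩ := hmaj.pair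
  rcases hrev.cases with ⟨h₁, h₂⟩ | ⟨h₁, h₂⟩
  · rw [max_eq_right h₂] at hi hj
    exact truncLaw_cdfle_of_snd c hij.ne h₁ (by linarith) (by linarith) hsum hrest hx
  · rw [max_eq_left h₂] at hi hj
    exact truncLaw_cdfle_of_snd c hij.ne' h₁ (by linarith) (by linarith) (by linarith)
      (fun m hj hi => hrest m hi hj) hx

lemma truncLaw_cdfle_of_relIncrFst {n : ℕ} (c : ℝ) {a b : VecPair n} (h : RelIncrFst a b) :
    CDFLE (truncLaw c a) (truncLaw c b) := by
  refine CDFLE.sumLaw (fun _ => isProbabilityMeasure_nb_trunc _ _)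
    (fun _ => isProbabilityMeasure_nb_trunc _ _) fun i => ?_
  rw [h.2]
  exact nb_cdfle_of_le_shape (le_max_right _ _) (max_le_max_right 0 (h.1 i)) (min_le_right _ _)

lemma truncLaw_cdfle_of_relDecrSnd {n : ℕ} (c : ℝ) {a b : VecPair n} (h : RelDecrSnd a b) :
    CDFLE (truncLaw c a) (truncLaw c b) := by
  refine CDFLE.sumLaw (fun _ => isProbabilityMeasure_nb_trunc _ _)
    (fun _ => isProbabilityMeasure_nb_trunc _ _) fun i => ?_
  rw [h.2]
  exact nb_cdfle_of_le_log (le_max_right _ _) (min_le_min_right 0 (sub_le_sub_right (h.1 i) c))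
    (min_le_right _ _)

lemma truncLaw_cdfle_of_rcMaj {n : ℕ} (c : ℝ) {a b : VecPair n} (h : RCMaj a b) :
    CDFLE (truncLaw c a) (truncLaw c b) := by
  induction h with
  | refl => exact CDFLE.refl _
  | tail _ hstep ih =>
    refine ih.trans ?_
    rcases hstep with hstep | hstep | hstep
    · rw [truncLaw_eq_of_arrEq c hstep]
      exact CDFLE.refl _
    · exact truncLaw_cdfle_of_relFst c hstep
    · exact truncLaw_cdfle_of_relSnd c hstep

lemma truncLaw_cdfle_of_weakRCMaj {n : ℕ} (c : ℝ) {a b : VecPair n} (h : WeakRCMaj a b) :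
    CDFLE (truncLaw c a) (truncLaw c b) := by
  induction h with
  | refl => exact CDFLE.refl _
  | tail _ hstep ih =>
    refine ih.trans ?_
    rcases hstep with hstep | hstep | hstep
    · exact truncLaw_cdfle_of_rcMaj c hstep
    · exact truncLaw_cdfle_of_relIncrFst c hstep
    · exact truncLaw_cdfle_of_relDecrSnd c hstep

lemma truncLaw_eq {n : ℕ} {c : ℝ} {a y : Fin n → ℝ} (ha : ∀ i, 0 < a i) (hy : ∀ i, y i ≤ c) :
    truncLaw c (a, y) = sumLaw fun i => nb (a i) (y i - c) := by
  unfold truncLaw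
  congr 1
  ext1 i
  rw [max_eq_left (ha i).le, min_eq_left (sub_nonpos.2 (hy i))]

lemma stochLE_negBinConv {n : ℕ} {α₁ α₂ p₁ p₂ : Fin n → ℝ} (hα₁ : ∀ i, 0 < α₁ i)
    (hα₂ : ∀ i, 0 < α₂ i) (hp₁ : ∀ i, 0 < p₁ i ∧ p₁ i < 1) (hp₂ : ∀ i, 0 < p₂ i ∧ p₂ i < 1)
    (h : WeakRCMaj (α₁, fun i => Real.log (p₁ i)) (α₂, fun i => Real.log (p₂ i))) :
    StochLE (negBinConv α₁ p₁) (negBinConv α₂ p₂) := by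
  have heq : ∀ {α p : Fin n → ℝ}, (∀ i, 0 < α i) → (∀ i, 0 < p i ∧ p i < 1) →
      negBinConv α p = truncLaw 0 (α, fun i => Real.log (p i)) := by
    intro α p hα hp
    rw [truncLaw_eq hα fun i => Real.log_nonpos (hp i).1.le (hp i).2.le, negBinConv]
    congr 1
    ext1 i
    rw [negBinMeasure_eq_nb _ (hp i).1, sub_zero]
  rw [heq hα₁ hp₁, heq hα₂ hp₂]
  have hprob : ∀ a : VecPair n, IsProbabilityMeasure (truncLaw 0 a) := fun a =>
    isProbabilityMeasure_sumLaw fun i => isProbabilityMeasure_nb_trunc (a.1 i) (a.2 i - 0)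
  have := hprob (α₁, fun i => Real.log (p₁ i))
  have := hprob (α₂, fun i => Real.log (p₂ i))
  exact StochLE.of_cdfle (truncLaw_cdfle_of_weakRCMaj 0 h)

/-! ### The characteristic function of the gamma distribution -/

/-- Exponential tilting turns a gamma density into a multiple of another one. -/
lemma lintegral_exp_mul_gammaMeasure {a r t : ℝ} (ha : 0 < a) (hr : 0 < r) (ht : t < r) :
    ∫⁻ x, ENNReal.ofReal (Real.exp (t * x)) ∂gammaMeasure a r =
      ENNReal.ofReal ((r / (r - t)) ^ a) := by
  have hrt : 0 < r - t := sub_pos.2 ht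
  have hmeas : ∀ s, Measurable (gammaPDF a s) := fun s =>
    (measurable_gammaPDFReal a s).ennreal_ofReal
  rw [gammaMeasure, lintegral_withDensity_eq_lintegral_mul _ (hmeas r) (by fun_prop)]
  calc ∫⁻ x, (gammaPDF a r * fun x => ENNReal.ofReal (Real.exp (t * x))) x
      = ∫⁻ x, ENNReal.ofReal ((r / (r - t)) ^ a) * gammaPDF a (r - t) x := by
        refine lintegral_congr fun x => ?_
        rw [Pi.mul_apply, gammaPDF, gammaPDF, ← ENNReal.ofReal_mul (gammaPDFReal_nonneg ha hr x),
          ← ENNReal.ofReal_mul (by positivity)]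
        congr 1
        unfold gammaPDFReal
        split_ifs with hx
        · rw [Real.div_rpow hr.le hrt.le, show -((r - t) * x) = -(r * x) + t * x by ring,
            Real.exp_add]
          have := Real.rpow_pos_of_pos hrt a
          field_simp
        · simp
    _ = ENNReal.ofReal ((r / (r - t)) ^ a) := by
        rw [lintegral_const_mul _ (hmeas _), lintegral_gammaPDF_eq_one ha hrt, mul_one]

lemma integrable_exp_mul_gammaMeasure {a r t : ℝ} (ha : 0 < a) (hr : 0 < r) (ht : t < r) :
    Integrable (fun x => Real.exp (t * x)) (gammaMeasure a r) := by
  refine (lintegral_ofReal_ne_top_iff_integrable (by fun_prop)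
    (ae_of_all _ fun x => (Real.exp_pos _).le)).1 ?_
  rw [lintegral_exp_mul_gammaMeasure ha hr ht]
  exact ENNReal.ofReal_ne_top

lemma mgf_gammaMeasure {a r t : ℝ} (ha : 0 < a) (hr : 0 < r) (ht : t < r) :
    mgf id (gammaMeasure a r) t = (r / (r - t)) ^ a := by
  have hrt : 0 < r - t := sub_pos.2 ht
  simp only [mgf, id]
  rw [integral_eq_lintegral_of_nonneg_ae (ae_of_all _ fun x => (Real.exp_pos _).le) (by fun_prop),
    lintegral_exp_mul_gammaMeasure ha hr ht, ENNReal.toReal_ofReal (by positivity)]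

/-- The moment generating function extends analytically to the half-plane `re z < r`, where it is
determined by its values on the real axis. -/
lemma charFun_gammaMeasure {a r : ℝ} (ha : 0 < a) (hr : 0 < r) (t : ℝ) :
    charFun (gammaMeasure a r) t = 1 / (1 - t * Complex.I / r) ^ (a : ℂ) := by
  set D : Set ℂ := {z | z.re < r} with hD
  have hDint : D ⊆ {z | z.re ∈ interior (integrableExpSet id (gammaMeasure a r))} := by
    have hsub : Iio r ⊆ interior (integrableExpSet id (gammaMeasure a r)) :=
      interior_maximal (fun s hs => integrable_exp_mul_gammaMeasure ha hr hs) isOpen_Iio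
    exact fun z hz => hsub hz
  have hDconv : Convex ℝ D := convex_halfSpace_re_lt r
  have hDopen : IsOpen D := isOpen_lt Complex.continuous_re continuous_const
  have hslit : ∀ z ∈ D, 1 - z / r ∈ Complex.slitPlane := by
    intro z hz
    left
    rw [Complex.sub_re, Complex.one_re, Complex.div_ofReal_re, sub_pos, div_lt_one hr]
    exact hz
  have hf : AnalyticOnNhd ℂ (complexMGF id (gammaMeasure a r)) D :=
    analyticOnNhd_complexMGF.mono hDint
  have hg : AnalyticOnNhd ℂ (fun z : ℂ => 1 / (1 - z / r) ^ (a : ℂ)) D := by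
    refine DifferentiableOn.analyticOnNhd (fun z hz => ?_) hDopen
    have hne : 1 - z / r ≠ 0 := Complex.slitPlane_ne_zero (hslit z hz)
    refine DifferentiableAt.differentiableWithinAt (DifferentiableAt.div (by fun_prop) ?_ ?_)
    · exact DifferentiableAt.cpow (by fun_prop) (by fun_prop) (hslit z hz)
    · rw [Ne, Complex.cpow_eq_zero_iff]
      exact fun h => hne h.1
  have hreal : ∀ s : ℝ, s < r → complexMGF id (gammaMeasure a r) s =
      1 / (1 - (s : ℂ) / r) ^ (a : ℂ) := by
    intro s hs
    have hrs : 0 < r - s := sub_pos.2 hs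
    rw [complexMGF_ofReal, mgf_gammaMeasure ha hr hs,
      show (1 : ℂ) - (s : ℂ) / r = (((r - s) / r : ℝ) : ℂ) by
        push_cast
        rw [sub_div, div_self (by exact_mod_cast hr.ne')],
      ← Complex.ofReal_cpow (by positivity), ← Complex.ofReal_one, ← Complex.ofReal_div, one_div,
      ← Real.inv_rpow (by positivity), inv_div]
  have h0 : (0 : ℂ) ∈ D := by simpa [hD] using hr
  have hfreq : ∃ᶠ z in 𝓝[≠] (0 : ℂ), complexMGF id (gammaMeasure a r) z =
      1 / (1 - z / r) ^ (a : ℂ) := by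
    have htend : Tendsto (fun s : ℝ => (s : ℂ)) (𝓝[≠] 0) (𝓝[≠] 0) := by
      refine tendsto_nhdsWithin_of_tendsto_nhds_of_eventually_within _ ?_ ?_
      · exact (Complex.continuous_ofReal.tendsto' 0 0 Complex.ofReal_zero).mono_left
          nhdsWithin_le_nhds
      · filter_upwards [self_mem_nhdsWithin] with s hs
        exact Complex.ofReal_ne_zero.2 hs
    refine htend.frequently (Eventually.frequently ?_)
    filter_upwards [nhdsWithin_le_nhds (Iio_mem_nhds hr)] with s hs using hreal s hs
  have heq := hf.eqOn_of_preconnected_of_frequently_eq hg hDconv.isPreconnected h0 hfreq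
  have hmem : (t * Complex.I : ℂ) ∈ D := by simpa [hD] using hr
  rw [← complexMGF_id_mul_I]
  exact heq hmem

/-! ### Gamma distributions as limits of negative binomial distributions -/

lemma tendsto_mul_exp_sub_one (t : ℝ) :
    Tendsto (fun N : ℕ => (N : ℂ) * (Complex.exp (((N : ℝ)⁻¹ * t : ℝ) * Complex.I) - 1)) atTop
      (𝓝 (t * Complex.I)) := by
  have hd : HasDerivAt (fun s : ℝ => Complex.exp ((s * t : ℝ) * Complex.I)) (t * Complex.I) 0 := by
    have h1 : HasDerivAt (fun s : ℝ => ((s * t : ℝ) : ℂ) * Complex.I) (t * Complex.I) 0 := by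
      have := ((hasDerivAt_id (0 : ℝ)).mul_const t).ofReal_comp.mul_const Complex.I
      simpa using this
    simpa using h1.cexp
  have hN : Tendsto (fun N : ℕ => (N : ℝ)⁻¹) atTop (𝓝[≠] 0) := by
    refine tendsto_nhdsWithin_of_tendsto_nhds_of_eventually_within _
      tendsto_inv_atTop_nhds_zero_nat ?_
    filter_upwards [eventually_gt_atTop 0] with N hN
    exact inv_ne_zero (Nat.cast_ne_zero.2 hN.ne')
  refine ((hasDerivAt_iff_tendsto_slope_zero.1 hd).comp hN).congr fun N => ?_
  simp [Complex.real_smul]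

lemma ofReal_mul_cpow {x : ℝ} (hx : 0 < x) {z : ℂ} (hz : z ≠ 0) (w : ℂ) :
    ((x : ℂ) * z) ^ w = (x : ℂ) ^ w * z ^ w := by
  have hxC : (x : ℂ) ≠ 0 := by exact_mod_cast hx.ne'
  rw [Complex.cpow_def_of_ne_zero (mul_ne_zero hxC hz), Complex.cpow_def_of_ne_zero hxC,
    Complex.cpow_def_of_ne_zero hz, Complex.log_ofReal_mul hx hz, Complex.ofReal_log hx.le,
    add_mul, Complex.exp_add]

/-- The rescaled characteristic functions of negative binomial distributions with success
probability `r / N` converge to that of a gamma distribution with rate `r`. -/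
lemma tendsto_charFun_nb {a r : ℝ} (ha : 0 < a) (hr : 0 < r) (t : ℝ) :
    Tendsto (fun N : ℕ => charFun (nb a (Real.log r - Real.log N)) ((N : ℝ)⁻¹ * t)) atTop
      (𝓝 (charFun (gammaMeasure a r) t)) := by
  rw [charFun_gammaMeasure ha hr]
  set e : ℕ → ℂ := fun N => Complex.exp (((N : ℝ)⁻¹ * t : ℝ) * Complex.I) with he
  have hslit : 1 - t * Complex.I / r ∈ Complex.slitPlane := by
    left
    simp
  have hlim : Tendsto (fun N : ℕ => e N - (N : ℂ) * (e N - 1) / r) atTop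
      (𝓝 (1 - t * Complex.I / r)) := by
    refine Tendsto.sub ?_ ((tendsto_mul_exp_sub_one t).div_const _)
    have h0 : Tendsto (fun N : ℕ => (((N : ℝ)⁻¹ * t : ℝ) : ℂ) * Complex.I) atTop (𝓝 0) := by
      have := ((tendsto_inv_atTop_nhds_zero_nat (𝕜 := ℝ)).mul_const t).ofReal.mul_const Complex.I
      simpa using this
    have h1 := h0.cexp
    rwa [Complex.exp_zero] at h1
  have hne : (1 - t * Complex.I / r) ^ (a : ℂ) ≠ 0 := by
    rw [Ne, Complex.cpow_eq_zero_iff]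
    exact fun h => Complex.slitPlane_ne_zero hslit h.1
  refine (tendsto_const_nhds.div ((hlim.cpow tendsto_const_nhds hslit)) hne).congr' ?_
  filter_upwards [eventually_gt_atTop 0, eventually_ge_atTop ⌈r⌉₊,
    hlim.eventually (Complex.isOpen_slitPlane.mem_nhds hslit)] with N hN0 hN hNslit
  have hN0' : (0 : ℝ) < N := Nat.cast_pos.2 hN0
  have hrN : r ≤ N := (Nat.le_ceil r).trans (Nat.cast_le.2 hN)
  have hv : Real.log r - Real.log N ≤ 0 := sub_nonpos.2 (Real.log_le_log hr hrN)
  have hexp : Real.exp (Real.log r - Real.log N) = r / N := by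
    rw [Real.exp_sub, Real.exp_log hr, Real.exp_log hN0']
  rw [charFun_nb ha.le hv, mul_comm a, Real.exp_mul, hexp]
  have hp : 0 < r / N := by positivity
  have hrC : (r : ℂ) ≠ 0 := by exact_mod_cast hr.ne'
  have hNC : (N : ℂ) ≠ 0 := by exact_mod_cast hN0.ne'
  -- The factor `r / N` of the base cancels against the normalizing constant `(r / N) ^ a`.
  have hbase : 1 - ((1 - r / N : ℝ) : ℂ) * e N =
      ((r / N : ℝ) : ℂ) * (e N - (N : ℂ) * (e N - 1) / r) := by
    push_cast
    field_simp
    ring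
  have hpa : ((r / N : ℝ) : ℂ) ^ (a : ℂ) ≠ 0 := by
    rw [Ne, Complex.cpow_eq_zero_iff]
    exact fun h => hp.ne' (by exact_mod_cast h.1)
  rw [hbase, ofReal_mul_cpow hp (Complex.slitPlane_ne_zero hNslit), Complex.ofReal_cpow hp.le,
    mul_one_div, div_mul_cancel_left₀ hpa, ← one_div]
  rfl

lemma tendsto_truncLaw_gammaConv {n : ℕ} {α β : Fin n → ℝ} (hα : ∀ i, 0 < α i)
    (hβ : ∀ i, 0 < β i) (t : ℝ) :
    Tendsto (fun N : ℕ => charFun ((truncLaw (Real.log N) (α, fun i => Real.log (β i))).map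
      ((N : ℝ)⁻¹ * ·)) t) atTop (𝓝 (charFun (gammaConv α β) t)) := by
  rw [gammaConv, charFun_sumLaw fun i => isProbabilityMeasure_gammaMeasure (hα i) (hβ i)]
  refine (tendsto_finsetProd _ fun i _ => tendsto_charFun_nb (hα i) (hβ i) t).congr' ?_
  have hN : ∀ᶠ N : ℕ in atTop, ∀ i, Real.log (β i) ≤ Real.log N := by
    refine eventually_all.2 fun i => ?_
    filter_upwards [eventually_ge_atTop ⌈β i⌉₊] with N hN
    exact Real.log_le_log (hβ i) ((Nat.le_ceil _).trans (Nat.cast_le.2 hN))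
  -- From here on no success probability `β i / N` exceeds `1`, and the truncation is inactive.
  filter_upwards [hN] with N hN
  rw [charFun_map_mul, truncLaw_eq hα hN,
    charFun_sumLaw fun i => isProbabilityMeasure_nb (hα i).le (sub_nonpos.2 (hN i))]

lemma stochLE_gammaConv {n : ℕ} {α₁ α₂ β₁ β₂ : Fin n → ℝ} (hα₁ : ∀ i, 0 < α₁ i)
    (hα₂ : ∀ i, 0 < α₂ i) (hβ₁ : ∀ i, 0 < β₁ i) (hβ₂ : ∀ i, 0 < β₂ i)
    (h : WeakRCMaj (α₁, fun i => Real.log (β₁ i)) (α₂, fun i => Real.log (β₂ i))) :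
    StochLE (gammaConv α₁ β₁) (gammaConv α₂ β₂) := by
  have hprob : ∀ (a : VecPair n) (N : ℕ),
      IsProbabilityMeasure ((truncLaw (Real.log N) a).map ((N : ℝ)⁻¹ * ·)) := fun a N =>
    have : IsProbabilityMeasure (truncLaw (Real.log N) a) :=
      isProbabilityMeasure_sumLaw fun i => isProbabilityMeasure_nb_trunc (a.1 i) _
    Measure.isProbabilityMeasure_map (by fun_prop)
  have hγ : ∀ {α β : Fin n → ℝ}, (∀ i, 0 < α i) → (∀ i, 0 < β i) →
      IsProbabilityMeasure (gammaConv α β) := fun hα hβ =>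
    isProbabilityMeasure_sumLaw fun i => isProbabilityMeasure_gammaMeasure (hα i) (hβ i)
  have hlim : ∀ {α β : Fin n → ℝ} (hα : ∀ i, 0 < α i) (hβ : ∀ i, 0 < β i),
      Tendsto (β := ProbabilityMeasure ℝ) (fun N : ℕ => ⟨_, hprob (α, fun i => Real.log (β i)) N⟩)
        atTop (𝓝 ⟨gammaConv α β, hγ hα hβ⟩) := fun hα hβ =>
    ProbabilityMeasure.tendsto_of_tendsto_charFun fun t => tendsto_truncLaw_gammaConv hα hβ t
  have := hγ hα₁ hβ₁
  have := hγ hα₂ hβ₂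
  refine StochLE.of_cdfle (CDFLE.of_tendsto (hlim hα₁ hβ₁) (hlim hα₂ hβ₂) ?_)
  filter_upwards [eventually_gt_atTop 0] with N hN
  exact (truncLaw_cdfle_of_weakRCMaj _ h).map_mul_const (inv_pos.2 (Nat.cast_pos.2 hN))

end

theorem mainTheorem3 (n : ℕ) :
    (∀ α₁ α₂ p₁ p₂ : Fin n → ℝ,
      (∀ i, 0 < α₁ i) → (∀ i, 0 < α₂ i) →
      (∀ i, 0 < p₁ i ∧ p₁ i < 1) → (∀ i, 0 < p₂ i ∧ p₂ i < 1) →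
      WeakRCMaj (α₁, fun i => Real.log (p₁ i)) (α₂, fun i => Real.log (p₂ i)) →
      StochLE (negBinConv α₁ p₁) (negBinConv α₂ p₂)) ∧
    (∀ α₁ α₂ β₁ β₂ : Fin n → ℝ,
      (∀ i, 0 < α₁ i) → (∀ i, 0 < α₂ i) →
      (∀ i, 0 < β₁ i) → (∀ i, 0 < β₂ i) →
      WeakRCMaj (α₁, fun i => Real.log (β₁ i)) (α₂, fun i => Real.log (β₂ i)) →
      StochLE (gammaConv α₁ β₁) (gammaConv α₂ β₂)) := by
  exact ⟨fun _ _ _ _ hα₁ hα₂ hp₁ hp₂ h => stochLE_negBinConv hα₁ hα₂ hp₁ hp₂ h,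
    fun _ _ _ _ hα₁ hα₂ hβ₁ hβ₂ h => stochLE_gammaConv hα₁ hα₂ hβ₁ hβ₂ h⟩
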